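/- An unambiguous finite automaton (UFA) is a nondeterministic finite automaton (with a set of start states, a set of accepting states and no $\varepsilon$-transitions) in which every accepted word has exactly one accepting run. All automata here are over a one-letter (unary) alphabet. \textbf{Theorem.} There are a constant $c>0$ and an $n_0\in\mathbb{N}$ such that for every integer $n\ge n_0$ the following hold. (1) There are unary languages $L$ and $H$, each recognised by an $n$-state UFA, such that every UFA recognising the concatenation $L\cdot H$ has at least $2^{c\,n^{1/6}}$ states. (2) There are $k\le n$ and unary languages $L_1,\dots,L_k$, each recognised by an $n$-state UFA, such that every UFA recognising the union $L_1\cup\dots\cup L_k$ has at least $2^{c\,n^{1/6}}$ states. That is, in the worst case both the concatenation of two $n$-state unary UFAs and the union of up to $n$ $n$-state unary UFAs require a UFA with $2^{\Omega(n^{1/6})}$ states. -/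

import Mathlib

/-- `q 0, …, q |w|` is an accepting run of `M` on the word `w`: it begins in a start state, follows
the transitions of `M` along the letters of `w`, and ends in an accepting state. -/
def NFA.IsAcceptingRun {α σ : Type*} (M : NFA α σ) (w : List α)
    (q : Fin (w.length + 1) → σ) : Prop :=
  q 0 ∈ M.start ∧
    (∀ i : Fin w.length, q i.succ ∈ M.step (q i.castSucc) (w.get i)) ∧
    q (Fin.last w.length) ∈ M.accept

/-- `M` is an unambiguous finite automaton: every word in the language of `M` has exactly one
accepting run, and every other word has none. -/
def NFA.IsUnambiguous {α σ : Type*} (M : NFA α σ) : Prop :=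
  ∀ w : List α,
    (w ∈ M.accepts → ∃! q : Fin (w.length + 1) → σ, M.IsAcceptingRun w q) ∧
    (w ∉ M.accepts → ¬ ∃ q : Fin (w.length + 1) → σ, M.IsAcceptingRun w q)

/-- The language `L` is recognised by some unambiguous finite automaton with exactly `n` states
(the state set is, up to renaming of states, `Fin n`). -/
def RecognisedByUFA {α : Type*} (n : ℕ) (L : Language α) : Prop :=
  ∃ M : NFA α (Fin n), M.IsUnambiguous ∧ M.accepts = L

/-! A UFA with `s` states for `K` factors any matrix `[x i ++ y j ∈ K]` through `ℚ^s`: unambiguity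
makes the sum over middle states 0 or 1. So `s` bounds its rank (`RecognisedByUFA.card_le`). For `k`
coprime moduli `p i`, the Chinese remainder theorem turns "some `p i` divides the length" into the
matrix `J - I` on subsets of `Fin k`, of full rank `2^k` (`exists_add_dvd_iff_ne`).

That language is a union of `k` cycles. As a concatenation, cycle `i` is stretched to length `k * p
i` and accepts residue `i`: distinct residues mod `k` keep the cycles disjoint, and a suffix shorter
than `k` hides which was used (`mem_concat_iff_exists_dvd`). With `p i ≤ 4 * k ^ 2` this costs at
most `4 * k ^ 4` states, within the budget `4 * k ^ 6 ≤ n`. -/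

namespace NFA

variable {α σ : Type*}

/-- Membership in `evalFrom` in terms of runs, indexed by all of `ℕ` for convenience. -/
theorem mem_evalFrom_iff_exists_run (M : NFA α σ) (w : List α) (S : Set σ) (q : σ) :
    q ∈ M.evalFrom S w ↔ ∃ r : ℕ → σ, r 0 ∈ S ∧
      (∀ i (h : i < w.length), r (i + 1) ∈ M.step (r i) w[i]) ∧ r w.length = q := by
  induction w generalizing S with
  | nil =>
    constructor
    · intro h
      exact ⟨fun _ => q, h, by simp, rfl⟩
    · rintro ⟨r, h0, -, rfl⟩
      exact h0
  | cons a w ih =>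
    rw [evalFrom_cons, ih]
    constructor
    · rintro ⟨r, h0, hr, hq⟩
      obtain ⟨s, hs, hsr⟩ := mem_stepSet.1 h0
      refine ⟨fun i => Nat.casesOn i s r, hs, ?_, hq⟩
      rintro (_ | i) h
      · exact hsr
      · exact hr i (by simpa using h)
    · rintro ⟨r, h0, hr, hq⟩
      refine ⟨fun i => r (i + 1), mem_stepSet.2 ⟨r 0, h0, hr 0 (by simp)⟩, fun i h => ?_, hq⟩
      exact hr (i + 1) (by simpa using h)

theorem isAcceptingRun_iff (M : NFA α σ) (w : List α) (r : ℕ → σ) :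
    M.IsAcceptingRun w (fun i => r i) ↔ r 0 ∈ M.start ∧
      (∀ i (h : i < w.length), r (i + 1) ∈ M.step (r i) w[i]) ∧ r w.length ∈ M.accept := by
  simp [IsAcceptingRun, Fin.forall_iff]

/-- In an unambiguous automaton, after reading `x` there is at most one reachable state from which
`y` leads to acceptance. -/
theorem IsUnambiguous.eq_of_mem_evalFrom {M : NFA α σ} (hM : M.IsUnambiguous) {x y : List α}
    {p q : σ} (hp : p ∈ M.evalFrom M.start x) (hq : q ∈ M.evalFrom M.start x)
    (hpy : y ∈ M.acceptsFrom {p}) (hqy : y ∈ M.acceptsFrom {q}) : p = q := by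
  -- Splice a run on `x` ending in `s` with an accepting run on `y` from `s`; distinct `p`, `q`
  -- would give accepting runs differing at position `x.length`.
  have key : ∀ s ∈ M.evalFrom M.start x, y ∈ M.acceptsFrom {s} →
      ∃ r : ℕ → σ, M.IsAcceptingRun (x ++ y) (fun i => r i) ∧ r x.length = s := by
    intro s hs hsy
    obtain ⟨t, ht, hty⟩ := M.mem_acceptsFrom.1 hsy
    obtain ⟨r, hr0, hr, hrs⟩ := (M.mem_evalFrom_iff_exists_run _ _ _).1 hs
    obtain ⟨r', hr0', hr', hrt⟩ := (M.mem_evalFrom_iff_exists_run _ _ _).1 hty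
    have hr0' : r' 0 = s := hr0'
    let f : ℕ → σ := fun i => if i ≤ x.length then r i else r' (i - x.length)
    refine ⟨f, (M.isAcceptingRun_iff _ f).2 ⟨by simpa [f] using hr0, fun i h => ?_, ?_⟩,
      by simpa [f] using hrs⟩ <;> dsimp only [f]
    · rcases lt_trichotomy i x.length with hi | rfl | hi
      · have := hr i hi
        simpa [hi.le, Nat.succ_le_of_lt hi, List.getElem_append_left hi] using this
      · have := hr' 0 (by simpa using h)
        simpa [hrs, hr0'] using this
      · have h1 : i - x.length < y.length := by simp at h; omega
        have := hr' (i - x.length) h1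
        rw [show i - x.length + 1 = i + 1 - x.length by omega] at this
        simpa [hi.not_ge, show ¬ i + 1 ≤ x.length by omega,
          List.getElem_append_right hi.le] using this
    · by_cases hy : y.length = 0
      · have : r' 0 = t := by rw [← hrt, hy]
        simp only [List.length_append, hy, add_zero, le_refl, if_true]
        rwa [hrs, ← hr0', this]
      · have : ¬ (x ++ y).length ≤ x.length := by
          rw [List.length_append]; omega
        simp only [this, if_false]
        simpa [hrt] using ht
  obtain ⟨r, hr, rfl⟩ := key p hp hpy
  obtain ⟨r', hr', rfl⟩ := key q hq hqy
  have hmem : x ++ y ∈ M.accepts := by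
    obtain ⟨t, ht, hty⟩ := M.mem_acceptsFrom.1 hpy
    refine M.mem_accepts.2 ⟨t, ht, ?_⟩
    rw [evalFrom_append]
    exact M.mem_evalFrom_iff_exists.2 ⟨_, hp, hty⟩
  have := ((hM _).1 hmem).unique hr hr'
  simpa using congrFun this ⟨x.length, by simp⟩

end NFA

/-! ### Rank lower bound -/

/-- A factorization of the matrix `J - I` through `σ` forces `σ` to be at least as large as the
index type. -/
theorem card_le_card_of_sum_mul_eq_ne {ι σ : Type*} [Fintype ι] [DecidableEq ι] [Fintype σ]
    (hι : Fintype.card ι ≠ 1) (A : ι → σ → ℚ) (B : σ → ι → ℚ)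
    (h : ∀ i j, ∑ q, A i q * B q j = if i = j then 0 else 1) :
    Fintype.card ι ≤ Fintype.card σ := by
  have hinj : Function.Injective (Matrix.toLin' (Matrix.of B)) := by
    rw [injective_iff_map_eq_zero]
    intro v hv
    have h0 : ∀ q, ∑ j, B q j * v j = 0 := fun q => by
      simpa [Matrix.mulVec, dotProduct] using congrFun hv q
    -- Row `i` of `(J - I) v = 0`.
    have h1 : ∀ i, v i = ∑ j, v j := fun i => by
      have h2 : ∑ j, (if i = j then 0 else 1) * v j = 0 := by
        calc _ = ∑ j, ∑ q, A i q * (B q j * v j) := by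
                simp_rw [← h, Finset.sum_mul, mul_assoc]
          _ = 0 := by
                rw [Finset.sum_comm]
                simp [← Finset.mul_sum, h0]
      have h3 : ∀ j, (if i = j then (0 : ℚ) else 1) * v j = v j - if i = j then v j else 0 := by
        intro j; split_ifs <;> simp
      simp_rw [h3, Finset.sum_sub_distrib] at h2
      simp at h2
      linarith
    have h2 : ∑ j, v j = 0 := by
      have h3 : ∑ j, v j = Fintype.card ι * ∑ j, v j := by
                calc ∑ j, v j = ∑ _j : ι, ∑ j, v j := Finset.sum_congr rfl fun i _ => h1 i
          _ = _ := by rw [Finset.sum_const, nsmul_eq_mul, Finset.card_univ]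
      have h4 : (Fintype.card ι - 1 : ℚ) ≠ 0 := sub_ne_zero.2 (by exact_mod_cast hι)
      exact (mul_eq_zero.1 (by linear_combination -h3 :
        (Fintype.card ι - 1 : ℚ) * ∑ j, v j = 0)).resolve_left h4
    funext i
    rw [h1, h2]; rfl
  simpa using LinearMap.finrank_le_finrank_of_injective hinj

/-- Lower bound for unambiguous automata: words `x i`, `y j` with `x i ++ y j ∈ K ↔ i ≠ j`
force at least as many states as there are indices. -/
theorem RecognisedByUFA.card_le {α ι : Type*} [Fintype ι] {s : ℕ} {K : Language α}
    (hK : RecognisedByUFA s K) (hι : Fintype.card ι ≠ 1) (x y : ι → List α)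
    (h : ∀ i j, x i ++ y j ∈ K ↔ i ≠ j) : Fintype.card ι ≤ s := by
  classical
  obtain ⟨M, hM, rfl⟩ := hK
  rw [← Fintype.card_fin s]
  refine card_le_card_of_sum_mul_eq_ne hι
    (fun i q => if q ∈ M.evalFrom M.start (x i) then 1 else 0)
    (fun q j => if y j ∈ M.acceptsFrom {q} then 1 else 0) fun i j => ?_
  have hij : (∃ q, q ∈ M.evalFrom M.start (x i) ∧ y j ∈ M.acceptsFrom {q}) ↔ i ≠ j := by
    rw [← h i j, M.mem_accepts]
    simp_rw [NFA.evalFrom_append, M.mem_acceptsFrom]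
    constructor
    · rintro ⟨q, hq, t, ht, hty⟩
      exact ⟨t, ht, M.mem_evalFrom_iff_exists.2 ⟨q, hq, hty⟩⟩
    · rintro ⟨t, ht, hty⟩
      obtain ⟨q, hq, hty⟩ := M.mem_evalFrom_iff_exists.1 hty
      exact ⟨q, hq, t, ht, hty⟩
  split_ifs with hij'
  · refine Finset.sum_eq_zero fun q _ => ?_
    by_contra hne
    refine hij.1 ⟨q, ?_⟩ hij'
    by_contra hcon
    apply hne
    by_cases h1 : q ∈ M.evalFrom M.start (x i)
    · simp [show y j ∉ M.acceptsFrom {q} from fun h2 => hcon ⟨h1, h2⟩]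
    · simp [h1]
  · obtain ⟨q, hq, hqy⟩ := hij.2 hij'
    rw [Finset.sum_eq_single q]
    · simp [hq, hqy]
    · intro p _ hpq
      by_contra hne
      apply hpq
      by_cases h1 : p ∈ M.evalFrom M.start (x i)
      · by_cases h2 : y j ∈ M.acceptsFrom {p}
        · exact hM.eq_of_mem_evalFrom h1 hq h2 hqy
        · simp [h2] at hne
      · simp [h1] at hne
    · simp

/-! ### Unary automata from iterated maps -/

/-- The unary language of all words whose length satisfies `P`. -/
def lengthLanguage (P : ℕ → Prop) : Language Unit := {w | P w.length}

theorem mem_lengthLanguage {P : ℕ → Prop} {w : List Unit} :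
    w ∈ lengthLanguage P ↔ P w.length := Iff.rfl

/-- The unary language accepted by a map `δ` started from each state in `S` is recognised
by an unambiguous automaton, provided that no two start states lead to acceptance of the same word. -/
theorem recognisedByUFA_of_iterate {σ : Type*} [Fintype σ] {n : ℕ} (hn : Fintype.card σ ≤ n)
    (δ : σ → σ) (S F : Set σ) {P : ℕ → Prop} (hP : ∀ m, P m ↔ ∃ a ∈ S, δ^[m] a ∈ F)
    (h : ∀ m, ∀ a ∈ S, ∀ b ∈ S, δ^[m] a ∈ F → δ^[m] b ∈ F → a = b) :
    RecognisedByUFA n (lengthLanguage P) := by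
  obtain ⟨e⟩ : Nonempty (σ ↪ Fin n) := Function.Embedding.nonempty_of_card_le (by simpa using hn)
  let M : NFA Unit (Fin n) :=
    { step := fun q _ => {q' | ∃ a, q = e a ∧ q' = e (δ a)}, start := e '' S, accept := e '' F }
  have run : ∀ (a : σ) (r : ℕ → Fin n) (m : ℕ), r 0 = e a →
      (∀ i < m, ∃ b, r i = e b ∧ r (i + 1) = e (δ b)) → ∀ i ≤ m, r i = e (δ^[i] a) := by
    intro a r m h0 hr i
    induction i with
    | zero => simpa using h0
    | succ i ih =>
      intro hi
      obtain ⟨b, hb, hb'⟩ := hr i hi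
      rw [ih (by omega)] at hb
      rw [hb', ← e.injective hb, Function.iterate_succ_apply']
  have acc : ∀ w : List Unit, w ∈ M.accepts ↔ ∃ a ∈ S, δ^[w.length] a ∈ F := by
    intro w
    rw [M.mem_accepts]
    simp_rw [M.mem_evalFrom_iff_exists_run]
    constructor
    · rintro ⟨_, ⟨f, hf, rfl⟩, r, ⟨a, ha, h0⟩, hr, hq⟩
      have := run a r w.length h0.symm hr _ le_rfl
      rw [this] at hq
      exact ⟨a, ha, by rwa [e.injective hq]⟩
    · rintro ⟨a, ha, hF⟩
      exact ⟨_, ⟨_, hF, rfl⟩, fun i => e (δ^[i] a), ⟨a, ha, rfl⟩,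
        fun i _ => ⟨_, rfl, congrArg e (Function.iterate_succ_apply' δ i a)⟩, rfl⟩
  have runs : ∀ (w : List Unit) (q : Fin (w.length + 1) → Fin n), M.IsAcceptingRun w q →
      ∃ a ∈ S, δ^[w.length] a ∈ F ∧ q = fun i : Fin (w.length + 1) => e (δ^[(i : ℕ)] a) := by
    intro w q hq
    -- `Fin.ofNat` wraps around past `w.length`, where the values of `r` are irrelevant.
    let r : ℕ → Fin n := fun i => q (Fin.ofNat _ i)
    have hqr : q = fun i : Fin (w.length + 1) => r (i : ℕ) := by
      funext i; simp [r]
    rw [hqr, M.isAcceptingRun_iff] at hq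
    obtain ⟨⟨a, ha, h0⟩, hr, ⟨f, hf, hl⟩⟩ := hq
    have := run a r w.length h0.symm hr
    refine ⟨a, ha, ?_, ?_⟩
    · rw [this _ le_rfl] at hl
      rwa [← e.injective hl]
    · rw [hqr]
      funext i
      exact this i (by omega)
  refine ⟨M, fun w => ⟨fun hw => ?_, ?_⟩, Set.ext fun w => (acc w).trans (hP _).symm⟩
  · obtain ⟨a, ha, hF⟩ := (acc w).1 hw
    refine ⟨fun i : Fin (w.length + 1) => e (δ^[(i : ℕ)] a), (M.isAcceptingRun_iff w fun i => e (δ^[i] a)).2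
      ⟨⟨a, ha, rfl⟩, fun i _ => ⟨_, rfl, congrArg e (Function.iterate_succ_apply' δ i a)⟩, ⟨_, hF, rfl⟩⟩, ?_⟩
    intro q hq
    obtain ⟨b, hb, hbF, rfl⟩ := runs w q hq
    rw [h _ b hb a ha hbF hF]
  · rintro hw ⟨q, hq⟩
    obtain ⟨a, ha, hF, -⟩ := runs w q hq
    exact hw ((acc w).2 ⟨a, ha, hF⟩)

/-! ### Coprime moduli -/

/-- For pairwise coprime moduli at least `2`, the property of being divisible by one of them
encodes the complement of the equality matrix on subsets. -/
theorem exists_add_dvd_iff_ne {k : ℕ} {p : Fin k → ℕ} (hp : ∀ i, 2 ≤ p i)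
    (hc : Pairwise (Function.onFun Nat.Coprime p)) :
    ∃ x y : Finset (Fin k) → ℕ, ∀ S T, (∃ i, p i ∣ x S + y T) ↔ S ≠ T := by
  have crt : ∀ a : Fin k → ℕ, ∃ z : ℕ, ∀ i, z ≡ a i [MOD p i] := fun a => by
    obtain ⟨z, hz⟩ := Nat.chineseRemainderOfFinset a p Finset.univ
      (fun i _ => by have := hp i; omega) (fun i _ j _ hij => hc hij)
    exact ⟨z, fun i => hz i (Finset.mem_univ i)⟩
  choose x hx using fun S : Finset (Fin k) => crt fun i => if i ∈ S then 1 else 0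
  -- Modulo `p i` the sum is 0 when `i` lies in exactly one of `S`, `T`; otherwise it is 1 (both) or
  -- -1 (neither), nonzero since `p i ≥ 2`.
  choose y hy using fun T : Finset (Fin k) => crt fun i => if i ∈ T then 0 else p i - 1
  have key : ∀ S T i, p i ∣ x S + y T ↔ ¬ (i ∈ S ↔ i ∈ T) := by
    intro S T i
    have h2 := hp i
    have h := (hx S i).add (hy T i)
    rw [(Nat.ModEq.dvd_iff h dvd_rfl)]
    by_cases hS : i ∈ S <;> by_cases hT : i ∈ T <;> simp only [hS, hT, if_true, if_false]
    · simp; omega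
    · simp [show 1 + (p i - 1) = p i by omega]
    · simp
    · simp only [zero_add, not_true, iff_false]
      exact fun hd => absurd (Nat.le_of_dvd (by omega) hd) (by omega)
  refine ⟨x, y, fun S T => ?_⟩
  simp_rw [key, ne_eq, Finset.ext_iff, not_forall]

theorem lcmUpto_le_pow_primeCounting (n : ℕ) : Nat.lcmUpto n ≤ n ^ Nat.primeCounting n := by
  rw [Nat.lcmUpto_eq_prod_pow_log, ← Nat.primesLE_card_eq_primeCounting]
  refine Finset.prod_le_pow_card _ _ _ fun p hp => Nat.pow_log_le_self p ?_
  have := Nat.le_of_mem_primesLE hp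
  have := Nat.two_le_of_mem_primesLE hp
  omega

/-- Chebyshev's argument: `2^N ≤ (N + 1) * lcm(1, …, N) ≤ (N + 1)^(π(N) + 1)`. For `N = 4 * k ^ 2`
the left side is `(16^k)^k`, so `π(N) < k` would contradict `N + 1 < 16^k`. -/
theorem le_primeCounting_four_mul_sq (k : ℕ) : k ≤ Nat.primeCounting (4 * k ^ 2) := by
  rcases Nat.eq_zero_or_pos k with rfl | hk
  · simp
  by_contra! hlt
  have h1 := Chebyshev.two_pow_le_mul_lcmUpto (4 * k ^ 2)
  have h2 : 4 * k ^ 2 + 1 < 16 ^ k := by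
    clear h1 hlt
    induction k, hk using Nat.le_induction with
    | base => norm_num
    | succ m hm ih => rw [pow_succ 16]; nlinarith
  have h3 : 2 ^ (4 * k ^ 2) ≤ (4 * k ^ 2 + 1) ^ k := by
    calc _ ≤ (4 * k ^ 2 + 1) * (4 * k ^ 2) ^ Nat.primeCounting (4 * k ^ 2) :=
          h1.trans (Nat.mul_le_mul_left _ (lcmUpto_le_pow_primeCounting _))
      _ ≤ (4 * k ^ 2 + 1) * (4 * k ^ 2 + 1) ^ Nat.primeCounting (4 * k ^ 2) := by gcongr; omega
      _ = (4 * k ^ 2 + 1) ^ (Nat.primeCounting (4 * k ^ 2) + 1) := by ring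
      _ ≤ _ := Nat.pow_le_pow_right (by omega) hlt
  have h4 : (4 * k ^ 2 + 1) ^ k < (16 ^ k) ^ k := Nat.pow_lt_pow_left h2 hk.ne'
  have h5 : (16 ^ k) ^ k = 2 ^ (4 * k ^ 2) := by
    rw [show 16 = 2 ^ 4 by norm_num, ← pow_mul, ← pow_mul]; ring_nf
  omega

theorem exists_coprime_le_four_mul_sq (k : ℕ) : ∃ p : Fin k → ℕ, (∀ i, 2 ≤ p i) ∧
    (∀ i, p i ≤ 4 * k ^ 2) ∧ Pairwise (Function.onFun Nat.Coprime p) := by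
  refine ⟨fun i => Nat.nth Nat.Prime i, fun i => (Nat.prime_nth_prime i).two_le, fun i => ?_,
    fun i j hij => ?_⟩
  · exact Nat.le_of_lt_succ (Nat.nth_lt_of_lt_count
      (i.2.trans_le (le_primeCounting_four_mul_sq k)))
  · refine (Nat.coprime_primes (Nat.prime_nth_prime i) (Nat.prime_nth_prime j)).2 fun h => hij ?_
    exact Fin.ext (Nat.nth_injective Nat.infinite_setOfPred_prime h)

/-! ### The automata -/

theorem recognisedByUFA_dvd_length {n p : ℕ} (hp : 0 < p) (hn : p ≤ n) :
    RecognisedByUFA n (lengthLanguage (p ∣ ·)) := by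
  have : NeZero p := ⟨hp.ne'⟩
  refine recognisedByUFA_of_iterate (σ := ZMod p) (by simpa using hn)
    (fun x => x + 1) {0} {0} (fun m => ?_) (by rintro m a rfl b rfl _ _; rfl)
  simp [add_right_iterate, ZMod.natCast_eq_zero_iff]

theorem recognisedByUFA_length_lt {n k : ℕ} (hn : k + 1 ≤ n) :
    RecognisedByUFA n (lengthLanguage (· < k)) := by
  -- State `k` is a rejecting sink.
  let δ : Fin (k + 1) → Fin (k + 1) := fun i => ⟨min (i + 1) k, by omega⟩
  have hδ : ∀ m, ((δ^[m] 0 : Fin (k + 1)) : ℕ) = min m k := by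
    intro m
    induction m with
    | zero => simp
    | succ m ih =>
      rw [Function.iterate_succ_apply']
      simp only [δ, ih]
      omega
  refine recognisedByUFA_of_iterate (by simpa using hn) δ {0} {i | (i : ℕ) < k}
    (fun m => ?_) (by rintro m a rfl b rfl _ _; rfl)
  simp [hδ]

/-- A disjoint union of `k` cycles whose `i`-th cycle accepts the residue `i` modulo `k * p i`. -/
theorem recognisedByUFA_exists_modEq {n k : ℕ} {p : Fin k → ℕ} (hp : ∀ i, 0 < p i)
    (hn : ∑ i, k * p i ≤ n) :
    RecognisedByUFA n (lengthLanguage fun m => ∃ i : Fin k, m ≡ i [MOD k * p i]) := by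
  have : ∀ i, NeZero (k * p i) := fun i => ⟨(Nat.mul_pos i.pos (hp i)).ne'⟩
  let δ : (Σ i, ZMod (k * p i)) → Σ i, ZMod (k * p i) := fun a => ⟨a.1, a.2 + 1⟩
  have hδ : ∀ m i, δ^[m] ⟨i, 0⟩ = ⟨i, (m : ZMod (k * p i))⟩ := by
    intro m i
    induction m with
    | zero => simp
    | succ m ih =>
      rw [Function.iterate_succ_apply', ih]
      simp [δ]
  have hF : ∀ m i, δ^[m] ⟨i, 0⟩ ∈ Set.range (fun j : Fin k =>
      (⟨j, ((j : ℕ) : ZMod (k * p j))⟩ : Σ i, ZMod (k * p i))) ↔ m ≡ i [MOD k * p i] := by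
    intro m i
    rw [hδ, ← ZMod.natCast_eq_natCast_iff]
    constructor
    · rintro ⟨j, hj⟩
      obtain ⟨rfl, h⟩ := Sigma.mk.inj_iff.1 hj
      exact (eq_of_heq h).symm
    · intro h
      exact ⟨i, by rw [h]⟩
  refine recognisedByUFA_of_iterate (by simpa [Fintype.card_sigma] using hn) δ
    (Set.range fun i => ⟨i, 0⟩) (Set.range fun i => ⟨i, ((i : ℕ) : ZMod (k * p i))⟩)
    (fun m => ?_) ?_
  · rw [Set.exists_range_iff]
    exact exists_congr fun i => (hF _ i).symm
  · rintro m _ ⟨i, rfl⟩ _ ⟨j, rfl⟩ hi hj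
    -- The factor `k` common to all cycle lengths makes the residue mod `k` identify the cycle.
    have h : (i : ℕ) ≡ j [MOD k] :=
      ((hF m i).1 hi).of_mul_right _ |>.symm.trans <| ((hF m j).1 hj).of_mul_right _
    have : i = j := Fin.ext (h.eq_of_lt_of_lt i.2 j.2)
    rw [this]

/-- Removing a suffix shorter than `k` leaves a length in the block `[k * t, k * t + k)`, which
meets each residue mod `k` once; cycle `i` can only accept at `k * t + i`. -/
theorem mem_concat_iff_exists_dvd {k t : ℕ} {p : Fin k → ℕ} {w : List Unit}
    (hw : w.length + 1 = k * t + k) :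
    w ∈ (lengthLanguage fun m => ∃ i : Fin k, m ≡ i [MOD k * p i]) *
      (lengthLanguage (· < k)) ↔ ∃ i, p i ∣ t := by
  have hmod : ∀ i : Fin k, k * t + i ≡ i [MOD k * p i] ↔ p i ∣ t := fun i => by
    rw [Nat.ModEq.comm, Nat.modEq_iff_dvd' (Nat.le_add_left _ _), Nat.add_sub_cancel]
    exact Nat.mul_dvd_mul_iff_left i.pos
  rw [Language.mem_mul]
  constructor
  · rintro ⟨a, ha, b, hb, rfl⟩
    rw [mem_lengthLanguage] at ha hb
    obtain ⟨i, hi⟩ := ha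
    rw [List.length_append] at hw
    have hlen : a.length = k * t + (k - 1 - b.length) := by omega
    have h : k - 1 - b.length ≡ i [MOD k] := by
      have := hi.of_mul_right (p i)
      rw [hlen] at this
      simpa [Nat.ModEq] using this
    have h' := h.eq_of_lt_of_lt (by omega) i.2
    rw [hlen, h'] at hi
    exact ⟨i, (hmod i).1 hi⟩
  · rintro ⟨i, hi⟩
    have := i.2
    refine ⟨w.take (k * t + i), mem_lengthLanguage.2 ⟨i, ?_⟩, w.drop (k * t + i), ?_, List.take_append_drop _ _⟩
    · rw [List.length_take, min_eq_left (by omega)]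
      exact (hmod i).2 hi
    · rw [mem_lengthLanguage, List.length_drop]
      omega

/-! ### Choice of parameters -/

theorem exists_pow_six_le {n : ℕ} (hn : 4 ≤ n) :
    ∃ k : ℕ, 0 < k ∧ 4 * k ^ 6 ≤ n ∧ (n : ℝ) ^ ((1 : ℝ) / 6) ≤ 4 * k := by
  let k := Nat.findGreatest (fun k => 4 * k ^ 6 ≤ n) n
  have h1 : 0 < k := Nat.findGreatest_pos.2 ⟨1, by norm_num, by omega, by omega⟩
  have h2 : 4 * k ^ 6 ≤ n :=
    Nat.findGreatest_spec (P := fun k => 4 * k ^ 6 ≤ n) (m := 0) (Nat.zero_le _) (by simp)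
  refine ⟨k, h1, h2, ?_⟩
  have hkn : k + 1 ≤ n := by
    have := Nat.le_self_pow (n := 6) (by norm_num) k
    omega
  have h3 : ¬ 4 * (k + 1) ^ 6 ≤ n :=
    Nat.findGreatest_is_greatest (P := fun k => 4 * k ^ 6 ≤ n) (Nat.lt_succ_self k) hkn
  have h4 : n ≤ (4 * k) ^ 6 := by
    have : (k + 1) ^ 6 ≤ (2 * k) ^ 6 := Nat.pow_le_pow_left (by omega) 6
    have h5 : (4 * k) ^ 6 = 64 * (2 * k) ^ 6 := by ring
    omega
  calc (n : ℝ) ^ ((1 : ℝ) / 6) ≤ (((4 * k : ℝ)) ^ 6) ^ ((1 : ℝ) / 6) :=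
        Real.rpow_le_rpow (by positivity) (by exact_mod_cast h4) (by norm_num)
    _ = 4 * k := by
        rw [← Real.rpow_natCast, ← Real.rpow_mul (by positivity)]
        norm_num

theorem mainTheorem3 :
    ∃ c : ℝ, 0 < c ∧ ∃ n₀ : ℕ, ∀ n : ℕ, n₀ ≤ n →
      (∃ L H : Language Unit, RecognisedByUFA n L ∧ RecognisedByUFA n H ∧
        ∀ s : ℕ, RecognisedByUFA s (L * H) →
          (2 : ℝ) ^ (c * (n : ℝ) ^ ((1 : ℝ) / 6)) ≤ (s : ℝ)) ∧
      (∃ k : ℕ, k ≤ n ∧ ∃ L : Fin k → Language Unit, (∀ i, RecognisedByUFA n (L i)) ∧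
        ∀ s : ℕ, RecognisedByUFA s (⨆ i, L i) →
          (2 : ℝ) ^ (c * (n : ℝ) ^ ((1 : ℝ) / 6)) ≤ (s : ℝ)) := by
  refine ⟨1 / 4, by norm_num, 4, fun n hn => ?_⟩
  obtain ⟨k, hk, hkn, hnk⟩ := exists_pow_six_le hn
  obtain ⟨p, hp2, hple, hpc⟩ := exists_coprime_le_four_mul_sq k
  obtain ⟨x, y, hxy⟩ := exists_add_dvd_iff_ne hp2 hpc
  have hpow : ∀ m ≤ 6, k ^ m ≤ k ^ 6 := fun m hm => Nat.pow_le_pow_right hk hm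
  have hk1 : k ≤ k ^ 6 := Nat.le_self_pow (by norm_num) k
  have hk2 := hpow 2 (by norm_num)
  have hk4 := hpow 4 (by norm_num)
  have hcard : Fintype.card (Finset (Fin k)) = 2 ^ k := by simp
  have hcard1 : Fintype.card (Finset (Fin k)) ≠ 1 := by
    rw [hcard]
    exact (Nat.one_lt_two_pow hk.ne').ne'
  have bound : ∀ s : ℕ, Fintype.card (Finset (Fin k)) ≤ s →
      (2 : ℝ) ^ (1 / 4 * (n : ℝ) ^ ((1 : ℝ) / 6)) ≤ (s : ℝ) := fun s hs => by
    calc (2 : ℝ) ^ (1 / 4 * (n : ℝ) ^ ((1 : ℝ) / 6)) ≤ (2 : ℝ) ^ (k : ℝ) :=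
          Real.rpow_le_rpow_of_exponent_le (by norm_num) (by linarith)
      _ = ((2 ^ k : ℕ) : ℝ) := by rw [Real.rpow_natCast]; norm_num
      _ ≤ s := by exact_mod_cast hcard ▸ hs
  constructor
  · refine ⟨_, _, recognisedByUFA_exists_modEq (p := p) (fun i => by have := hp2 i; omega) ?_,
      recognisedByUFA_length_lt (k := k) (by omega), fun s hs => bound s ?_⟩
    · calc ∑ i, k * p i ≤ ∑ _i : Fin k, k * (4 * k ^ 2) :=
            Finset.sum_le_sum fun i _ => Nat.mul_le_mul_left _ (hple i)
        _ = 4 * k ^ 4 := by simp; ring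
        _ ≤ n := by omega
    -- The padding `k - 1` puts the total length at the end of a block, with `t = x S + y T`.
    · refine hs.card_le hcard1 (fun S => List.replicate (k * x S) ())
        (fun T => List.replicate (k * y T + (k - 1)) ()) fun S T => ?_
      rw [mem_concat_iff_exists_dvd (t := x S + y T), hxy]
      simp only [List.length_append, List.length_replicate, mul_add]
      omega
  · refine ⟨k, by omega, fun i => lengthLanguage (p i ∣ ·), fun i => recognisedByUFA_dvd_length
      (by have := hp2 i; omega) ((hple i).trans (by omega)), fun s hs => bound s ?_⟩
    refine hs.card_le hcard1 (fun S => List.replicate (x S) ())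
      (fun T => List.replicate (y T) ()) fun S T => ?_
    rw [← hxy, Language.mem_iSup]
    refine exists_congr fun i => ?_
    simp [mem_lengthLanguage]
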